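/- Let $S$ and $M$ be finite-dimensional quantum systems (measured system and memory) with Hamiltonians $H_S$, $H_M$, let $\beta>0$ be an inverse temperature, and let $S(\rho)=-\mathrm{tr}[\rho\ln\rho]$ and $F(\rho)=\mathrm{tr}[\rho H_M]-S(\rho)/\beta$ denote the von Neumann entropy and the free energy of the memory. Let $\{T_k\}_{k=1}^K$ be a quantum instrument on $S$, i.e. completely positive maps with $\sum_k T_k^*(\mathbb 1)=\mathbb 1$. Its inefficiency $I$ is the maximum over $k$ of the Kraus rank of $T_k$ (the least number of operators $M_{ki}$ with $T_k(\rho)=\sum_i M_{ki}\rho M_{ki}^\dagger$); it is efficient if each $T_k$ has the form $\rho\mapsto M_k\rho M_k^\dagger$. Let $(\rho_M,U_{SM},\{Q_k\})$ be an implementation of $\{T_k\}$: $\rho_M$ is a state of $M$, $U_{SM}$ a unitary on $S\otimes M$, the $Q_k$ are orthogonal projections on $M$ with $\sum_k Q_k=\mathbb 1$, and for all states $\rho$ of $S$ and all $k$ $$\mathrm{tr}_M\big[(\mathbb 1\otimes Q_k)U_{SM}(\rho\otimes\rho_M)U_{SM}^\dagger(\mathbb 1\otimes Q_k)\big]=T_k(\rho).$$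 For a state $\rho_S$ of $S$ put $\rho'_{SM}=\sum_k(\mathbb 1\otimes Q_k)U_{SM}(\rho_S\otimes\rho_M)U_{SM}^\dagger(\mathbb 1\otimes Q_k)$, with marginals $\rho'_S=\sum_k T_k(\rho_S)$ and $\rho'_M$, and $\Delta E_S=\mathrm{tr}[H_S(\rho'_S-\rho_S)]$. The energy cost of operating the device on $\rho_S$ is $E_{\mathrm{cost}}=\Delta E_{\mathcal M}+\Delta E_{\mathcal R}$, where $\Delta E_{\mathcal M}=\Delta E_S+\mathrm{tr}[H_M(\rho'_M-\rho_M)]$ is the cost of the measurement step and $\Delta E_{\mathcal R}$ is the cost of resetting the memory: either the ideal value $\Delta E_{\mathcal R}=-(F(\rho'_M)-F(\rho_M))$, or the value $\Delta E_{\mathcal R}=\mathrm{tr}[(H_M+H_B)(\rho''_{MB}-\rho'_M\otimes\tau_B)]$ of an actual resetting step with a finite-dimensional bath $B$ in the thermal state $\tau_B=e^{-\beta H_B}/\mathrm{tr}[e^{-\beta H_B}]$ and a unitary $U_{MB}$ such that $\rho''_{MB}=U_{MB}(\rho'_M\otimes\tau_B)U_{MB}^\dagger$ satisfies $\mathrm{tr}_B[\rho''_{MB}]=\rho_M$.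 Then $$\beta E_{\mathrm{cost}}\ \ge\ \beta\,\Delta E_S-\ln I .$$ In particular, if the instrument is efficient, then the extracted energy $E_{\mathrm{ext}}=\Delta E_S-E_{\mathrm{cost}}$ satisfies $E_{\mathrm{ext}}\le 0$: efficient measurements can never yield energy. -/

import Mathlib

noncomputable section

namespace QMeasurement

open Matrix
open scoped Kronecker ComplexOrder

/-- Density matrices: the states of a finite-dimensional quantum system. -/
structure IsState {n : Type*} [Fintype n] (ρ : Matrix n n ℂ) : Prop where
  posSemidef : ρ.PosSemidef
  trace_eq_one : ρ.trace = 1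

/-- The partial trace over the second tensor factor. -/
def traceSnd {a b : Type*} [Fintype b] (X : Matrix (a × b) (a × b) ℂ) : Matrix a a ℂ :=
  Matrix.of fun i j => ∑ k, X (i, k) (j, k)

/-- The partial trace over the first tensor factor. -/
def traceFst {a b : Type*} [Fintype a] (X : Matrix (a × b) (a × b) ℂ) : Matrix b b ℂ :=
  Matrix.of fun i j => ∑ k, X (k, i) (k, j)

/-- The von Neumann entropy `-tr (ρ ln ρ)`; here `Real.negMulLog x = -x ln x`, with `0 ln 0 = 0`,
is applied to the Hermitian matrix `ρ` by functional calculus. -/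
def entropy {n : Type*} [Fintype n] [DecidableEq n] (ρ : Matrix n n ℂ) : ℝ :=
  (cfc Real.negMulLog ρ).trace.re

/-- The free energy `tr (ρ H) - S(ρ) / β`. -/
def freeEnergy {n : Type*} [Fintype n] [DecidableEq n] (β : ℝ) (H ρ : Matrix n n ℂ) : ℝ :=
  (ρ * H).trace.re - entropy ρ / β

/-- The change `tr (H (ρ' - ρ))` of the mean energy from the state `ρ` to the state `ρ'`. -/
def energyChange {n : Type*} [Fintype n] (H ρ ρ' : Matrix n n ℂ) : ℝ :=
  (H * (ρ' - ρ)).trace.re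

/-- The thermal state `exp (-β H) / tr (exp (-β H))`. -/
def thermalState {n : Type*} [Fintype n] [DecidableEq n] (β : ℝ) (H : Matrix n n ℂ) :
    Matrix n n ℂ :=
  (NormedSpace.exp (-(β : ℂ) • H)).trace⁻¹ • NormedSpace.exp (-(β : ℂ) • H)

/-- A linear map `T` on matrices is completely positive if `T ⊗ id` preserves positive
semidefiniteness for every ancilla dimension. -/
def IsCompletelyPositive {s : Type*} (T : Matrix s s ℂ →ₗ[ℂ] Matrix s s ℂ) : Prop :=
  ∀ (n : ℕ) (X : Matrix (s × Fin n) (s × Fin n) ℂ), X.PosSemidef →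
    (Matrix.of fun (p q : s × Fin n) =>
      T (Matrix.of fun i j => X (i, p.2) (j, q.2)) p.1 q.1).PosSemidef

/-- `M` is a family of Kraus (measurement) operators of `T`: `T X = ∑ i, M i * X * (M i)ᴴ`. -/
def IsKrausFamily {s ι : Type*} [Fintype s] [Fintype ι] (T : Matrix s s ℂ →ₗ[ℂ] Matrix s s ℂ)
    (M : ι → Matrix s s ℂ) : Prop :=
  ∀ X, T X = ∑ i, M i * X * (M i)ᴴ

/-- The Kraus rank: the least number of operators in a Kraus decomposition. -/
def krausRank {s : Type*} [Fintype s] (T : Matrix s s ℂ →ₗ[ℂ] Matrix s s ℂ) : ℕ :=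
  sInf {n : ℕ | ∃ M : Fin n → Matrix s s ℂ, IsKrausFamily T M}

/-- A quantum instrument with outcomes `k : K`: completely positive maps `T k` with
`∑ k, (T k)^* 1 = 1`, that is, whose sum preserves the trace. -/
structure Instrument (K s : Type*) [Fintype K] [Fintype s] where
  T : K → Matrix s s ℂ →ₗ[ℂ] Matrix s s ℂ
  completelyPositive : ∀ k, IsCompletelyPositive (T k)
  trace_preserving : ∀ X, (∑ k, T k X).trace = X.trace

namespace Instrument

variable {K s : Type*} [Fintype K] [Fintype s]

/-- The average post-measurement state `∑ k, p k • ρ' k = ∑ k, T k ρ`. -/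
def averageState (𝒯 : Instrument K s) (ρ : Matrix s s ℂ) : Matrix s s ℂ :=
  ∑ k, 𝒯.T k ρ

/-- The inefficiency: the maximal Kraus rank of the elements of the instrument. -/
def inefficiency (𝒯 : Instrument K s) : ℕ :=
  Finset.univ.sup fun k => krausRank (𝒯.T k)

/-- An instrument is efficient if each outcome has a single measurement operator. -/
def IsEfficient (𝒯 : Instrument K s) : Prop :=
  ∀ k, ∃ M : Matrix s s ℂ, ∀ X, 𝒯.T k X = M * X * Mᴴ

end Instrument

/-- A measurement device for a system `s` with outcomes in `K`: the initial state `ρM` of the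
memory `m`, the unitary `U` on system and memory, and the projections `Q k` on the memory
by which the outcome is read out. -/
structure Device (K s m : Type*) [Fintype K] [Fintype s] [DecidableEq s] [Fintype m]
    [DecidableEq m] where
  ρM : Matrix m m ℂ
  isState : IsState ρM
  U : Matrix (s × m) (s × m) ℂ
  unitary : U ∈ Matrix.unitaryGroup (s × m) ℂ
  Q : K → Matrix m m ℂ
  Q_isHermitian : ∀ k, (Q k).IsHermitian
  Q_idempotent : ∀ k, Q k * Q k = Q k
  Q_sum : ∑ k, Q k = 1

namespace Device

variable {K s m : Type*} [Fintype K] [Fintype s] [DecidableEq s] [Fintype m] [DecidableEq m]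

/-- The unnormalized state `p k • ρ'_{SM,k}` of system and memory after outcome `k`; its trace is
the probability `p k` of that outcome. -/
def branch (D : Device K s m) (ρS : Matrix s s ℂ) (k : K) : Matrix (s × m) (s × m) ℂ :=
  ((1 : Matrix s s ℂ) ⊗ₖ D.Q k) * (D.U * (ρS ⊗ₖ D.ρM) * D.Uᴴ) * ((1 : Matrix s s ℂ) ⊗ₖ D.Q k)

/-- The state `ρ'_{SM} = ∑ k, p k • ρ'_{SM,k}` after the measurement step. -/
def postState (D : Device K s m) (ρS : Matrix s s ℂ) : Matrix (s × m) (s × m) ℂ :=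
  ∑ k, D.branch ρS k

/-- The state `ρ'_M` of the memory after the measurement step. -/
def postMemory (D : Device K s m) (ρS : Matrix s s ℂ) : Matrix m m ℂ :=
  traceFst (D.postState ρS)

/-- The device implements the instrument if, for every input state, each outcome has the correct
probability and leaves the system in the correct state; for unnormalized states this is the
single equation `tr_M (p k • ρ'_{SM,k}) = T k ρ`. -/
def Implements (D : Device K s m) (𝒯 : Instrument K s) : Prop :=
  ∀ ρ : Matrix s s ℂ, IsState ρ → ∀ k, traceSnd (D.branch ρ k) = 𝒯.T k ρ

/-- The energy cost `tr (H_S (ρ'_S - ρ_S)) + tr (H_M (ρ'_M - ρ_M))` of the measurement step. -/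
def measurementCost (D : Device K s m) (HS : Matrix s s ℂ) (HM : Matrix m m ℂ)
    (ρS : Matrix s s ℂ) : ℝ :=
  energyChange HS ρS (traceSnd (D.postState ρS)) + energyChange HM D.ρM (D.postMemory ρS)

/-- The energy cost of an ideal resetting step: minus the change of the memory's free energy in the
measurement step. -/
def idealResetCost (D : Device K s m) (β : ℝ) (HM : Matrix m m ℂ) (ρS : Matrix s s ℂ) : ℝ :=
  -(freeEnergy β HM (D.postMemory ρS) - freeEnergy β HM D.ρM)

/-- A resetting step: a thermal bath `b` with Hamiltonian `HB` at inverse temperature `β`, and a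
unitary on memory and bath which takes the memory back to its initial state. -/
structure Reset (D : Device K s m) (β : ℝ) (ρS : Matrix s s ℂ) (b : Type*) [Fintype b]
    [DecidableEq b] where
  HB : Matrix b b ℂ
  HB_isHermitian : HB.IsHermitian
  U : Matrix (m × b) (m × b) ℂ
  unitary : U ∈ Matrix.unitaryGroup (m × b) ℂ
  resets : traceSnd (U * (D.postMemory ρS ⊗ₖ thermalState β HB) * Uᴴ) = D.ρM

/-- The energy cost `tr ((H_M + H_B) (ρ''_{MB} - ρ'_{MB}))` of a resetting step. -/
def Reset.cost {D : Device K s m} {β : ℝ} {ρS : Matrix s s ℂ} {b : Type*} [Fintype b]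
    [DecidableEq b] (R : D.Reset β ρS b) (HM : Matrix m m ℂ) : ℝ :=
  energyChange (HM ⊗ₖ (1 : Matrix b b ℂ) + (1 : Matrix m m ℂ) ⊗ₖ R.HB)
    (D.postMemory ρS ⊗ₖ thermalState β R.HB)
    (R.U * (D.postMemory ρS ⊗ₖ thermalState β R.HB) * R.Uᴴ)

/-- `E` is an overall energy cost `ΔE_M + ΔE_R` of operating the device once on the input `ρS`, where
the resetting step is ideal or is carried out with some finite-dimensional thermal bath. -/
inductive IsEnergyCost (D : Device K s m) (β : ℝ) (HS : Matrix s s ℂ) (HM : Matrix m m ℂ)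
    (ρS : Matrix s s ℂ) : ℝ → Prop
  | ideal : IsEnergyCost D β HS HM ρS
      (D.measurementCost HS HM ρS + D.idealResetCost β HM ρS)
  | bath (d : ℕ) (R : D.Reset β ρS (Fin d)) : IsEnergyCost D β HS HM ρS
      (D.measurementCost HS HM ρS + R.cost HM)

end Device

end QMeasurement

end

/-!
The energy terms of the memory cancel between measurement and reset, so that the claim reduces to
two entropy inequalities: `S(ρ'_M) - S(ρ_M) ≤ β (ΔE_R + tr H_M (ρ'_M - ρ_M))`, and
`S(ρ_M) ≤ S(ρ'_M) + ln I`.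

The first is an equality for the ideal reset. For a reset with a thermal bath it is Landauer's
principle (`Device.Reset.entropy_sub_le_cost`): the unitary preserves the entropy
`S(ρ'_M) + S(τ_B)`, which by subadditivity is at most `S(ρ_M) + S(ρ''_B)`, and by the Gibbs
variational principle `S(ρ''_B) - S(τ_B)` is at most `β` times the energy gained by the bath.

For the second (`Device.entropy_memory_le`), let `p k` be the outcome probabilities and write entropies
of unnormalized states as `S(X) = -tr X ln X`. The projective readout does not lower the entropy
`S(ρ_S) + S(ρ_M)`, subadditivity splits each branch between system and memory, and the memory parts
are mutually orthogonal, whence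
`S(ρ_S) + S(ρ_M) ≤ S(ρ'_M) + ∑ k, (S(T_k ρ_S) + p k ln (p k))`.
It remains to see that the last sum is at most `S(ρ_S) + ln I` (`Instrument.sum_entropy_le`). With
`ρ_S = B Bᴴ` and Kraus operators `M_ki`, the outcome state `∑ i, M_ki B Bᴴ M_kiᴴ` has, up to an excess
of `p k ln I`, at most the entropy of `R_k = ∑ i, Bᴴ M_kiᴴ M_ki B`. The `R_k` add up to `Bᴴ B`, which
has the entropy of `ρ_S`, so that concavity of the entropy gives the bound.

All quantum inequalities come from a single one, `entropy_le_sum_negMulLog_diag`: a rank-one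
measurement does not lower the entropy. Applied in suitable eigenbases it turns subadditivity and
the increase of entropy under projective measurements into statements about finite distributions.
Concavity is subadditivity for block diagonal states. Logarithms of singular matrices are avoided,
so that no support conditions arise.
-/

noncomputable section

namespace QMeasurement

open Matrix
open scoped Kronecker ComplexOrder

/-! ### Scalar inequalities -/

/-- The tangent to `-x ln x` at `y` lies above the graph. For `y = 0` the tangent is vertical,
which is why `x` has to vanish there as well. -/
lemma negMulLog_le_tangent {x y : ℝ} (hx : 0 ≤ x) (hy : 0 ≤ y) (hxy : y = 0 → x = 0) :
    Real.negMulLog x ≤ -x * Real.log y + y - x := by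
  rcases hx.eq_or_lt with rfl | hx
  · simpa using hy
  have hy' : 0 < y := lt_of_le_of_ne hy fun h => hx.ne' (hxy h.symm)
  have h := Real.log_le_sub_one_of_pos (div_pos hy' hx)
  rw [Real.log_div hy'.ne' hx.ne'] at h
  have h2 := mul_le_mul_of_nonneg_left h hx.le
  have h3 : x * (y / x - 1) = y - x := by field_simp
  rw [Real.negMulLog]
  linarith

/-- The Shannon entropy is at most the logarithm of the number of outcomes, here for
unnormalized distributions. -/
lemma sum_negMulLog_le {ι : Type*} [Fintype ι] (x : ι → ℝ) (hx : ∀ i, 0 ≤ x i) :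
    ∑ i, Real.negMulLog (x i) ≤
      Real.negMulLog (∑ i, x i) + (∑ i, x i) * Real.log (Fintype.card ι) := by
  rcases isEmpty_or_nonempty ι with h | h
  · simp
  have hn : (0 : ℝ) < Fintype.card ι := by exact_mod_cast Fintype.card_pos
  set t := ∑ i, x i with ht
  have ht0 : 0 ≤ t := Finset.sum_nonneg fun i _ => hx i
  have hle : ∀ i, Real.negMulLog (x i) ≤
      -x i * Real.log (t / Fintype.card ι) + t / Fintype.card ι - x i := fun i => by
    refine negMulLog_le_tangent (hx i) (by positivity) fun h0 => ?_
    have h1 : t = 0 := by simpa [hn.ne'] using h0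
    exact (Finset.sum_eq_zero_iff_of_nonneg fun i _ => hx i).1 h1 i (Finset.mem_univ i)
  refine (Finset.sum_le_sum fun i _ => hle i).trans (le_of_eq ?_)
  rw [Finset.sum_sub_distrib, Finset.sum_add_distrib, ← Finset.sum_mul, Finset.sum_neg_distrib,
    ← ht]
  simp only [Finset.sum_const, Finset.card_univ, nsmul_eq_mul, mul_div_cancel₀ _ hn.ne']
  rcases ht0.eq_or_lt with h0 | h0
  · simp [← h0]
  · rw [Real.log_div h0.ne' hn.ne', Real.negMulLog]
    ring

/-- Subadditivity of the Shannon entropy, for unnormalized distributions. -/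
lemma sum_negMulLog_le_marginals {ι κ : Type*} [Fintype ι] [Fintype κ] (d : ι × κ → ℝ)
    (hd : ∀ p, 0 ≤ d p) :
    ∑ p, Real.negMulLog (d p) + Real.negMulLog (∑ p, d p) ≤
      ∑ i, Real.negMulLog (∑ j, d (i, j)) + ∑ j, Real.negMulLog (∑ i, d (i, j)) := by
  set a : ι → ℝ := fun i => ∑ j, d (i, j) with ha
  set b : κ → ℝ := fun j => ∑ i, d (i, j) with hb
  set t := ∑ p, d p with ht
  have hat : ∑ i, a i = t := (Fintype.sum_prod_type d).symm
  have hbt : ∑ j, b j = t := (Fintype.sum_prod_type_right d).symm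
  have ha0 : ∀ i, 0 ≤ a i := fun i => Finset.sum_nonneg fun j _ => hd _
  have hb0 : ∀ j, 0 ≤ b j := fun j => Finset.sum_nonneg fun i _ => hd _
  have ht0 : 0 ≤ t := Finset.sum_nonneg fun p _ => hd _
  have hda : ∀ i j, d (i, j) ≤ a i := fun i j =>
    Finset.single_le_sum (f := fun j => d (i, j)) (fun j _ => hd _) (Finset.mem_univ j)
  have hdb : ∀ i j, d (i, j) ≤ b j := fun i j =>
    Finset.single_le_sum (f := fun i => d (i, j)) (fun i _ => hd _) (Finset.mem_univ i)
  have hdt : ∀ p, d p ≤ t := fun p => Finset.single_le_sum (fun p _ => hd p) (Finset.mem_univ p)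
  have hle : ∀ i j, Real.negMulLog (d (i, j)) ≤ -(d (i, j) * Real.log (a i))
      - d (i, j) * Real.log (b j) + d (i, j) * Real.log t + a i * b j / t - d (i, j) := by
    intro i j
    rcases (hd (i, j)).eq_or_lt with h0 | h0
    · have := div_nonneg (mul_nonneg (ha0 i) (hb0 j)) ht0
      simpa [← h0] using this
    · have h1 := h0.trans_le (hda i j)
      have h2 := h0.trans_le (hdb i j)
      have h3 := h0.trans_le (hdt (i, j))
      have h4 : 0 < a i * b j / t := by positivity
      have h5 := negMulLog_le_tangent h0.le h4.le fun h => absurd h h4.ne'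
      rw [Real.log_div (by positivity) h3.ne', Real.log_mul h1.ne' h2.ne'] at h5
      linarith
  have hsum := Finset.sum_le_sum fun i (_ : i ∈ Finset.univ) =>
    Finset.sum_le_sum fun j (_ : j ∈ Finset.univ) => hle i j
  simp only [Finset.sum_sub_distrib, Finset.sum_add_distrib, Finset.sum_neg_distrib] at hsum
  have e1 : ∑ i, ∑ j, d (i, j) * Real.log (a i) = -∑ i, Real.negMulLog (a i) := by
    simp only [← Finset.sum_mul, Real.negMulLog, neg_mul, Finset.sum_neg_distrib, neg_neg]
    rfl
  have e2 : ∑ i, ∑ j, d (i, j) * Real.log (b j) = -∑ j, Real.negMulLog (b j) := by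
    rw [Finset.sum_comm]
    simp only [← Finset.sum_mul, Real.negMulLog, neg_mul, Finset.sum_neg_distrib, neg_neg]
    rfl
  have e3 : ∑ i, ∑ j, d (i, j) * Real.log t = -Real.negMulLog t := by
    rw [← Fintype.sum_prod_type (fun p => d p * Real.log t), ← Finset.sum_mul, ← ht,
      Real.negMulLog]
    ring
  have e4 : ∑ i, ∑ j, a i * b j / t = t := by
    simp only [← Finset.sum_div, ← Finset.mul_sum, ← Finset.sum_mul, hat, hbt]
    exact mul_self_div_self t
  have e5 : ∑ i, ∑ j, d (i, j) = t := hat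
  rw [e1, e2, e3, e4, e5, ← Fintype.sum_prod_type (fun p => Real.negMulLog (d p))] at hsum
  linarith

/-! ### The entropy in terms of the spectrum -/

section Spectrum

variable {n m : Type*} [Fintype n] [DecidableEq n] [Fintype m] [DecidableEq m]

omit [Fintype n] in
lemma isHermitian_diagonal_ofReal (x : n → ℝ) :
    (diagonal fun i => (x i : ℂ)).IsHermitian :=
  isHermitian_diagonal_of_self_adjoint _ (by ext i; simp)

lemma exists_diagonalization {X : Matrix n n ℂ} (hX : X.IsHermitian) :
    ∃ (V : Matrix n n ℂ) (x : n → ℝ), V * Vᴴ = 1 ∧ Vᴴ * V = 1 ∧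
      X = V * diagonal (fun i => (x i : ℂ)) * Vᴴ ∧ Vᴴ * X * V = diagonal fun i => (x i : ℂ) := by
  have h1 : (hX.eigenvectorUnitary : Matrix n n ℂ) * (hX.eigenvectorUnitary : Matrix n n ℂ)ᴴ = 1 :=
    Unitary.coe_mul_star_self hX.eigenvectorUnitary
  have h2 : (hX.eigenvectorUnitary : Matrix n n ℂ)ᴴ * (hX.eigenvectorUnitary : Matrix n n ℂ) = 1 :=
    Unitary.coe_star_mul_self hX.eigenvectorUnitary
  have h3 := hX.spectral_theorem
  rw [Unitary.conjStarAlgAut_apply] at h3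
  refine ⟨hX.eigenvectorUnitary, hX.eigenvalues, h1, h2, h3, ?_⟩
  nth_rw 2 [h3]
  rw [← Matrix.mul_assoc, ← Matrix.mul_assoc, h2, Matrix.one_mul, Matrix.mul_assoc]
  erw [h2]
  rw [Matrix.mul_one]
  rfl

lemma eigenvalue_nonneg {X V : Matrix n n ℂ} {x : n → ℝ} (hX : X.PosSemidef)
    (h : Vᴴ * X * V = diagonal fun i => (x i : ℂ)) (i : n) : 0 ≤ x i := by
  have h1 := (hX.conjTranspose_mul_mul_same V).diag_nonneg (i := i)
  rw [h, diagonal_apply_eq] at h1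
  exact_mod_cast h1

/-- The entropy depends only on the multiset of eigenvalues, read off as the roots of the
characteristic polynomial. -/
lemma entropy_eq_sum_roots {X : Matrix n n ℂ} (hX : X.IsHermitian) :
    entropy X = (X.charpoly.roots.map fun z => Real.negMulLog z.re).sum := by
  rw [hX.roots_charpoly_eq_eigenvalues, entropy, hX.cfc_eq, IsHermitian.cfc,
    Unitary.conjStarAlgAut_apply, Matrix.trace_mul_cycle, Unitary.coe_star_mul_self, one_mul,
    Matrix.trace_diagonal]
  simp

lemma entropy_eq_of_charpoly_eq {X Y : Matrix n n ℂ} (hX : X.IsHermitian) (hY : Y.IsHermitian)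
    (h : X.charpoly = Y.charpoly) : entropy X = entropy Y := by
  rw [entropy_eq_sum_roots hX, entropy_eq_sum_roots hY, h]

lemma entropy_diagonal (x : n → ℝ) :
    entropy (diagonal fun i => (x i : ℂ)) = ∑ i, Real.negMulLog (x i) := by
  rw [entropy_eq_sum_roots (isHermitian_diagonal_ofReal x),
    charpoly_diagonal, Polynomial.roots_prod _ _
      (Finset.prod_ne_zero_iff.2 fun i _ => Polynomial.X_sub_C_ne_zero _)]
  simp [Multiset.bind_singleton]

lemma entropy_conj {X V : Matrix n n ℂ} (hX : X.IsHermitian) (hV : Vᴴ * V = 1) :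
    entropy (V * X * Vᴴ) = entropy X := by
  refine entropy_eq_of_charpoly_eq (isHermitian_mul_mul_conjTranspose V hX) hX ?_
  rw [charpoly_mul_comm, ← mul_assoc, hV, one_mul]

lemma entropy_conj_diagonal {V : Matrix n n ℂ} (hV : Vᴴ * V = 1) (x : n → ℝ) :
    entropy (V * diagonal (fun i => (x i : ℂ)) * Vᴴ) = ∑ i, Real.negMulLog (x i) := by
  rw [entropy_conj (isHermitian_diagonal_ofReal x) hV, entropy_diagonal]

/-- `A Aᴴ` and `Aᴴ A` have the same nonzero eigenvalues, and zero does not contribute to the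
entropy. -/
lemma entropy_mul_conjTranspose_comm (A : Matrix m n ℂ) :
    entropy (A * Aᴴ) = entropy (Aᴴ * A) := by
  rw [entropy_eq_sum_roots (isHermitian_mul_conjTranspose_self A),
    entropy_eq_sum_roots (isHermitian_conjTranspose_mul_self A)]
  have h := congrArg Polynomial.roots (charpoly_mul_comm' A Aᴴ)
  rw [Polynomial.roots_mul, Polynomial.roots_mul, Polynomial.roots_X_pow,
    Polynomial.roots_X_pow] at h
  · have h' := congrArg (fun s : Multiset ℂ => (s.map fun z => Real.negMulLog z.re).sum) h
    simpa [Multiset.map_nsmul, Multiset.sum_nsmul] using h'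
  · exact mul_ne_zero (pow_ne_zero _ Polynomial.X_ne_zero) (charpoly_monic _).ne_zero
  · exact mul_ne_zero (pow_ne_zero _ Polynomial.X_ne_zero) (charpoly_monic _).ne_zero

lemma charpoly_blockDiagonal (M : m → Matrix n n ℂ) :
    (blockDiagonal M).charpoly = ∏ k, (M k).charpoly := by
  have h : charmatrix (blockDiagonal M) = blockDiagonal fun k => charmatrix (M k) := by
    ext ⟨i, k⟩ ⟨j, l⟩
    by_cases hkl : k = l <;> by_cases hij : i = j <;>
      simp [blockDiagonal_apply, hkl, hij]
  simp only [charpoly]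
  rw [h, det_blockDiagonal]

lemma entropy_blockDiagonal (M : m → Matrix n n ℂ) (hM : ∀ k, (M k).IsHermitian) :
    entropy (blockDiagonal M) = ∑ k, entropy (M k) := by
  have hB : (blockDiagonal M).IsHermitian := by
    rw [IsHermitian, blockDiagonal_conjTranspose]
    congr 1
    ext1 k
    exact hM k
  rw [entropy_eq_sum_roots hB, charpoly_blockDiagonal, Polynomial.roots_prod]
  · rw [Multiset.map_bind, Multiset.sum_bind]
    simp only [entropy_eq_sum_roots (hM _)]
    rfl
  · exact Finset.prod_ne_zero_iff.2 fun k _ => (charpoly_monic _).ne_zero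

end Spectrum

/-! ### Entropy inequalities -/

section Inequalities

variable {n m ι : Type*} [Fintype n] [Fintype ι]

lemma diag_conj_nonneg {X : Matrix n n ℂ} (hX : X.PosSemidef) (W : Matrix n ι ℂ) (j : ι) :
    0 ≤ ((Wᴴ * X * W) j j).re :=
  (Complex.nonneg_iff.1 ((hX.conjTranspose_mul_mul_same W).diag_nonneg (i := j))).1

/-- The columns of a matrix `A` with orthonormal rows have norm at most one: `Aᴴ * A` is a
projection. -/
lemma sum_normSq_col_le_one [DecidableEq n] {A : Matrix n ι ℂ} (hA : A * Aᴴ = 1) (j : ι) :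
    ∑ i, Complex.normSq (A i j) ≤ 1 := by
  set P := Aᴴ * A with hP
  have hPP : P * P = P := by
    rw [hP, Matrix.mul_assoc, ← Matrix.mul_assoc A, hA, Matrix.one_mul]
  have hPh : Pᴴ = P := isHermitian_conjTranspose_mul_self A
  have hjj : P j j = ((∑ i, Complex.normSq (A i j) : ℝ) : ℂ) := by
    simp [hP, mul_apply, Complex.normSq_eq_conj_mul_self]
  set t := ∑ i, Complex.normSq (A i j) with ht
  have hsq : t = ∑ k, Complex.normSq (P k j) := by
    have h := congrFun (congrFun hPP j) j
    rw [mul_apply, hjj] at h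
    have h2 : ∀ k, P j k * P k j = ((Complex.normSq (P k j) : ℝ) : ℂ) := fun k => by
      rw [Complex.normSq_eq_conj_mul_self]
      congr 1
      exact (congrFun (congrFun hPh j) k).symm
    simp only [h2] at h
    exact_mod_cast h.symm
  have hle : t * t ≤ t := by
    have := Finset.single_le_sum (f := fun k => Complex.normSq (P k j))
      (fun k _ => Complex.normSq_nonneg _) (Finset.mem_univ j)
    rw [← hsq] at this
    simpa [hjj] using this
  nlinarith

/-- The entropy of the outcome distribution of a rank-one measurement is at least the entropy of
the state. The columns of `W` are the (unnormalized) measurement vectors; they need only resolve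
the identity, not be orthogonal. -/
lemma entropy_le_sum_negMulLog_diag [DecidableEq n] {X : Matrix n n ℂ} (hX : X.PosSemidef) {W : Matrix n ι ℂ}
    (hW : W * Wᴴ = 1) :
    entropy X ≤ ∑ j, Real.negMulLog ((Wᴴ * X * W) j j).re := by
  obtain ⟨V, x, hV, hV', hXV, hXV'⟩ := exists_diagonalization hX.1
  have hS : entropy X = ∑ i, Real.negMulLog (x i) := by
    rw [hXV, entropy_conj_diagonal hV']
  have hx := eigenvalue_nonneg hX hXV'
  set A := Vᴴ * W with hA
  have hAA : A * Aᴴ = 1 := by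
    rw [hA, conjTranspose_mul, conjTranspose_conjTranspose, Matrix.mul_assoc, ← Matrix.mul_assoc W,
      hW, Matrix.one_mul, hV']
  have hcol := sum_normSq_col_le_one hAA
  have hrow : ∀ i, ∑ j, Complex.normSq (A i j) = 1 := fun i => by
    have h := congrFun (congrFun hAA i) i
    simp only [mul_apply, conjTranspose_apply, RCLike.star_def, Complex.mul_conj,
      one_apply_eq] at h
    exact_mod_cast h
  have hd : ∀ j, ((Wᴴ * X * W) j j).re = ∑ i, Complex.normSq (A i j) * x i := fun j => by
    have h : Wᴴ * X * W = Aᴴ * diagonal (fun i => (x i : ℂ)) * A := by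
      rw [hXV, hA, conjTranspose_mul, conjTranspose_conjTranspose]
      simp only [Matrix.mul_assoc]
    rw [h, mul_apply, Complex.re_sum]
    refine Finset.sum_congr rfl fun i _ => ?_
    rw [mul_diagonal, conjTranspose_apply, mul_right_comm, RCLike.star_def,
      ← Complex.normSq_eq_conj_mul_self, ← Complex.ofReal_mul, Complex.ofReal_re]
  set d : ι → ℝ := fun j => ∑ i, Complex.normSq (A i j) * x i with hdd
  have hd0 : ∀ j, 0 ≤ d j := fun j =>
    Finset.sum_nonneg fun i _ => mul_nonneg (Complex.normSq_nonneg _) (hx i)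
  -- Jensen's inequality for the weights `|A i j|²`, by comparison with the tangent at `d j`
  have hkey : ∀ j, ∑ i, Complex.normSq (A i j) * Real.negMulLog (x i) ≤ Real.negMulLog (d j) := by
    intro j
    have h1 : ∀ i, Complex.normSq (A i j) * Real.negMulLog (x i) ≤
        -(Complex.normSq (A i j) * x i * Real.log (d j)) + Complex.normSq (A i j) * d j
          - Complex.normSq (A i j) * x i := fun i => by
      rcases (Complex.normSq_nonneg (A i j)).eq_or_lt with h0 | h0
      · simp [← h0]
      · have h2 := negMulLog_le_tangent (hx i) (hd0 j) fun hz => by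
          have := (Finset.sum_eq_zero_iff_of_nonneg fun i _ =>
            mul_nonneg (Complex.normSq_nonneg (A i j)) (hx i)).1 hz i (Finset.mem_univ i)
          exact (mul_eq_zero.1 this).resolve_left h0.ne'
        have h3 := mul_le_mul_of_nonneg_left h2 h0.le
        linarith
    refine (Finset.sum_le_sum fun i _ => h1 i).trans ?_
    rw [Finset.sum_sub_distrib, Finset.sum_add_distrib, Finset.sum_neg_distrib, ← Finset.sum_mul,
      ← Finset.sum_mul, Real.negMulLog]
    have := mul_le_mul_of_nonneg_right (hcol j) (hd0 j)
    change -(d j * _) + _ - d j ≤ _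
    linarith
  rw [hS]
  calc ∑ i, Real.negMulLog (x i)
      = ∑ i, ∑ j, Complex.normSq (A i j) * Real.negMulLog (x i) := by
        simp only [← Finset.sum_mul, hrow, one_mul]
    _ = ∑ j, ∑ i, Complex.normSq (A i j) * Real.negMulLog (x i) := Finset.sum_comm
    _ ≤ ∑ j, Real.negMulLog (d j) := Finset.sum_le_sum fun j _ => hkey j
    _ = _ := by simp only [hd, hdd]

/-- Each state has an orthonormal basis whose diagonal entries attain equality in
`entropy_le_sum_negMulLog_diag`. -/
lemma exists_eigenbasis [DecidableEq n] {X : Matrix n n ℂ} (hX : X.IsHermitian) :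
    ∃ V : Matrix n n ℂ, V * Vᴴ = 1 ∧ Vᴴ * V = 1 ∧
      entropy X = ∑ j, Real.negMulLog ((Vᴴ * X * V) j j).re := by
  obtain ⟨V, x, hV, hV', hXV, hXV'⟩ := exists_diagonalization hX
  refine ⟨V, hV, hV', ?_⟩
  rw [hXV']
  nth_rw 1 [hXV]
  rw [entropy_conj_diagonal hV']
  simp

/-- The block row `(M k)_k`; its columns are indexed by `n × ι`, with the block index second, as in
`Matrix.blockDiagonal`. -/
def blockRow (M : ι → Matrix m n ℂ) : Matrix m (n × ι) ℂ :=
  Matrix.of fun a p => M p.2 a p.1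

omit [Fintype n] [Fintype ι] in
lemma conjTranspose_blockRow_mul_apply [Fintype m] (M N : ι → Matrix m n ℂ) (p q : n × ι) :
    ((blockRow M)ᴴ * blockRow N) p q = ((M p.2)ᴴ * N q.2) p.1 q.1 := by
  simp [blockRow, mul_apply]

lemma blockRow_mul_conjTranspose (M : ι → Matrix m n ℂ) :
    blockRow M * (blockRow M)ᴴ = ∑ k, M k * (M k)ᴴ := by
  ext a b
  simp [blockRow, mul_apply, Matrix.sum_apply, Fintype.sum_prod_type_right]

/-- A measurement with operators `Q k` does not lower the entropy when its outcome is kept in a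
classical register. -/
lemma entropy_le_sum_entropy_conj [DecidableEq n] {X : Matrix n n ℂ} (hX : X.PosSemidef) {Q : ι → Matrix n n ℂ}
    (hQ : ∑ k, Q k * (Q k)ᴴ = 1) :
    entropy X ≤ ∑ k, entropy ((Q k)ᴴ * X * Q k) := by
  choose V hV _ hVS using fun k =>
    exists_eigenbasis (hX.conjTranspose_mul_mul_same (Q k)).1
  have hW : blockRow (fun k => Q k * V k) * (blockRow fun k => Q k * V k)ᴴ = 1 := by
    rw [blockRow_mul_conjTranspose, ← hQ]
    refine Finset.sum_congr rfl fun k _ => ?_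
    rw [conjTranspose_mul, Matrix.mul_assoc, ← Matrix.mul_assoc (V k), hV, Matrix.one_mul]
  refine (entropy_le_sum_negMulLog_diag hX hW).trans (le_of_eq ?_)
  rw [Fintype.sum_prod_type_right]
  refine Finset.sum_congr rfl fun k _ => ?_
  rw [hVS]
  refine Finset.sum_congr rfl fun j _ => ?_
  have hXW : X * blockRow (fun k => Q k * V k) = blockRow fun k => X * (Q k * V k) := by
    ext a p
    simp [blockRow, mul_apply]
  rw [Matrix.mul_assoc, hXW, conjTranspose_blockRow_mul_apply, conjTranspose_mul]
  simp only [Matrix.mul_assoc]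

lemma exists_eq_mul_conjTranspose [DecidableEq n] {X : Matrix n n ℂ} (hX : X.PosSemidef) :
    ∃ B : Matrix n n ℂ, X = B * Bᴴ := by
  obtain ⟨V, x, -, -, hXV, hXV'⟩ := exists_diagonalization hX.1
  have hx := eigenvalue_nonneg hX hXV'
  refine ⟨V * diagonal fun i => (Real.sqrt (x i) : ℂ), ?_⟩
  rw [conjTranspose_mul, diagonal_conjTranspose, Matrix.mul_assoc, ← Matrix.mul_assoc (diagonal _),
    diagonal_mul_diagonal, ← Matrix.mul_assoc]
  nth_rw 1 [hXV]
  congr 3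
  ext i
  simp only [Pi.star_apply, RCLike.star_def, Complex.conj_ofReal, ← Complex.ofReal_mul,
    Real.mul_self_sqrt (hx i)]

/-- The entropy is additive over mutually orthogonal summands. -/
lemma entropy_sum_orthogonal [DecidableEq n] {X : Matrix n n ℂ} (hX : X.PosSemidef) {Q : ι → Matrix n n ℂ}
    (hQ : ∀ k l, k ≠ l → (Q k)ᴴ * Q l = 0) :
    entropy (∑ k, Q k * X * (Q k)ᴴ) = ∑ k, entropy (Q k * X * (Q k)ᴴ) := by
  classical
  obtain ⟨B, rfl⟩ := exists_eq_mul_conjTranspose hX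
  have h1 : ∀ k, Q k * (B * Bᴴ) * (Q k)ᴴ = (Q k * B) * (Q k * B)ᴴ := fun k => by
    rw [conjTranspose_mul]
    simp only [Matrix.mul_assoc]
  have h2 : (blockRow fun k => Q k * B)ᴴ * blockRow (fun k => Q k * B) =
      blockDiagonal fun k => (Q k * B)ᴴ * (Q k * B) := by
    ext p q
    rw [conjTranspose_blockRow_mul_apply, blockDiagonal_apply]
    split_ifs with h
    · rw [h]
    · rw [conjTranspose_mul, Matrix.mul_assoc, ← Matrix.mul_assoc (Q p.2)ᴴ, hQ _ _ h]
      simp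
  simp only [h1]
  rw [← blockRow_mul_conjTranspose, entropy_mul_conjTranspose_comm, h2,
    entropy_blockDiagonal _ fun k => isHermitian_conjTranspose_mul_self _]
  simp only [entropy_mul_conjTranspose_comm]

end Inequalities

/-! ### Partial traces -/

section PartialTrace

variable {a b : Type*} [Fintype a] [Fintype b]

omit [Fintype a] in
lemma posSemidef_traceSnd {X : Matrix (a × b) (a × b) ℂ} (hX : X.PosSemidef) :
    (traceSnd X).PosSemidef := by
  have : traceSnd X = ∑ k, X.submatrix (fun i => (i, k)) (fun i => (i, k)) := by
    ext i j
    simp [traceSnd, Matrix.sum_apply]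
  rw [this]
  exact posSemidef_sum _ fun k _ => hX.submatrix _

omit [Fintype b] in
lemma posSemidef_traceFst {X : Matrix (a × b) (a × b) ℂ} (hX : X.PosSemidef) :
    (traceFst X).PosSemidef := by
  have : traceFst X = ∑ k, X.submatrix (fun i => (k, i)) (fun i => (k, i)) := by
    ext i j
    simp [traceFst, Matrix.sum_apply]
  rw [this]
  exact posSemidef_sum _ fun k _ => hX.submatrix _

lemma trace_traceSnd (X : Matrix (a × b) (a × b) ℂ) : (traceSnd X).trace = X.trace := by
  simp [traceSnd, Matrix.trace, Fintype.sum_prod_type]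

omit [Fintype a] in
lemma traceSnd_kronecker (A : Matrix a a ℂ) (B : Matrix b b ℂ) :
    traceSnd (A ⊗ₖ B) = B.trace • A := by
  ext i j
  simp [traceSnd, Matrix.trace, ← Finset.mul_sum, mul_comm]

omit [Fintype b] in
lemma traceFst_kronecker (A : Matrix a a ℂ) (B : Matrix b b ℂ) :
    traceFst (A ⊗ₖ B) = A.trace • B := by
  ext i j
  simp [traceFst, Matrix.trace, ← Finset.sum_mul]

lemma trace_traceFst (X : Matrix (a × b) (a × b) ℂ) : (traceFst X).trace = X.trace := by
  simp [traceFst, Matrix.trace, Fintype.sum_prod_type_right]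

lemma trace_kronecker_one_mul [DecidableEq b] (A : Matrix a a ℂ) (X : Matrix (a × b) (a × b) ℂ) :
    ((A ⊗ₖ (1 : Matrix b b ℂ)) * X).trace = (A * traceSnd X).trace := by
  simp only [Matrix.trace, diag_apply, mul_apply, kroneckerMap_apply, one_apply, traceSnd,
    of_apply, Fintype.sum_prod_type, mul_ite, mul_one, mul_zero, ite_mul, zero_mul,
    Finset.sum_ite_eq, Finset.mem_univ, if_true, Finset.mul_sum]
  exact Finset.sum_congr rfl fun i _ => Finset.sum_comm

lemma trace_one_kronecker_mul [DecidableEq a] (B : Matrix b b ℂ) (X : Matrix (a × b) (a × b) ℂ) :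
    (((1 : Matrix a a ℂ) ⊗ₖ B) * X).trace = (B * traceFst X).trace := by
  simp only [Matrix.trace, diag_apply, mul_apply, kroneckerMap_apply, one_apply, traceFst,
    of_apply, Fintype.sum_prod_type_right, ite_mul, one_mul, zero_mul,
    Finset.sum_ite_eq, Finset.mem_univ, if_true, Finset.mul_sum]
  exact Finset.sum_congr rfl fun i _ => Finset.sum_comm

lemma traceSnd_conj_kronecker [DecidableEq b] (X : Matrix (a × b) (a × b) ℂ) (A A' : Matrix a a ℂ)
    {B B' : Matrix b b ℂ} (hB : B' * B = 1) :
    traceSnd ((A ⊗ₖ B) * X * (A' ⊗ₖ B')) = A * traceSnd X * A' := by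
  refine ext_iff_trace_mul_left.2 fun C => ?_
  rw [← trace_kronecker_one_mul, ← Matrix.mul_assoc, trace_mul_comm, ← Matrix.mul_assoc,
    ← Matrix.mul_assoc, ← mul_kronecker_mul, ← mul_kronecker_mul, Matrix.mul_one, hB,
    trace_kronecker_one_mul, ← Matrix.mul_assoc, ← Matrix.mul_assoc, trace_mul_comm _ A']
  simp only [Matrix.mul_assoc]

lemma traceFst_conj_kronecker [DecidableEq a] (X : Matrix (a × b) (a × b) ℂ) {A A' : Matrix a a ℂ}
    (B B' : Matrix b b ℂ) (hA : A' * A = 1) :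
    traceFst ((A ⊗ₖ B) * X * (A' ⊗ₖ B')) = B * traceFst X * B' := by
  refine ext_iff_trace_mul_left.2 fun C => ?_
  rw [← trace_one_kronecker_mul, ← Matrix.mul_assoc, trace_mul_comm, ← Matrix.mul_assoc,
    ← Matrix.mul_assoc, ← mul_kronecker_mul, ← mul_kronecker_mul, Matrix.mul_one, hA,
    trace_one_kronecker_mul, ← Matrix.mul_assoc, ← Matrix.mul_assoc, trace_mul_comm _ B']
  simp only [Matrix.mul_assoc]

/-- Subadditivity of the von Neumann entropy, for unnormalized states. -/
lemma entropy_add_negMulLog_trace_le [DecidableEq a] [DecidableEq b] {X : Matrix (a × b) (a × b) ℂ} (hX : X.PosSemidef) :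
    entropy X + Real.negMulLog X.trace.re ≤ entropy (traceSnd X) + entropy (traceFst X) := by
  obtain ⟨V, hV, hV', hVS⟩ := exists_eigenbasis (posSemidef_traceSnd hX).1
  obtain ⟨W, hW, hW', hWS⟩ := exists_eigenbasis (posSemidef_traceFst hX).1
  have hVW : (V ⊗ₖ W) * (V ⊗ₖ W)ᴴ = 1 := by
    rw [conjTranspose_kronecker, ← mul_kronecker_mul, hV, hW, one_kronecker_one]
  set Y := (V ⊗ₖ W)ᴴ * X * (V ⊗ₖ W) with hY
  have h1 := entropy_le_sum_negMulLog_diag hX hVW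
  have h2 := sum_negMulLog_le_marginals (fun p => (Y p p).re) fun p => diag_conj_nonneg hX _ p
  have ht : ∑ p, (Y p p).re = X.trace.re := by
    have : Y.trace = X.trace := by
      rw [hY, trace_mul_cycle, hVW, Matrix.one_mul]
    rw [← this, Matrix.trace, Complex.re_sum]
    rfl
  have hs : traceSnd Y = Vᴴ * traceSnd X * V := by
    rw [hY, conjTranspose_kronecker, traceSnd_conj_kronecker _ _ _ hW]
  have hf : traceFst Y = Wᴴ * traceFst X * W := by
    rw [hY, conjTranspose_kronecker, traceFst_conj_kronecker _ _ _ hV]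
  rw [← hs] at hVS
  rw [← hf] at hWS
  simp only [traceSnd, traceFst, Matrix.of_apply, Complex.re_sum] at hVS hWS
  rw [ht] at h2
  change entropy (traceSnd X) = _ at hVS
  change entropy (traceFst X) = _ at hWS
  rw [hVS, hWS]
  linarith

lemma entropy_le_negMulLog_trace_add [DecidableEq a] {X : Matrix a a ℂ} (hX : X.PosSemidef) :
    entropy X ≤ Real.negMulLog X.trace.re + X.trace.re * Real.log (Fintype.card a) := by
  have h1 := entropy_le_sum_negMulLog_diag hX (W := (1 : Matrix a a ℂ)) (by simp)
  have h2 := sum_negMulLog_le _ fun i => diag_conj_nonneg hX (1 : Matrix a a ℂ) i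
  refine h1.trans (h2.trans (le_of_eq ?_))
  simp [Matrix.trace]

lemma entropy_kronecker [DecidableEq a] [DecidableEq b] {A : Matrix a a ℂ} {B : Matrix b b ℂ} (hA : A.IsHermitian)
    (hB : B.IsHermitian) (hA1 : A.trace = 1) (hB1 : B.trace = 1) :
    entropy (A ⊗ₖ B) = entropy A + entropy B := by
  obtain ⟨V, x, hV, hV', hVA, -⟩ := exists_diagonalization hA
  obtain ⟨W, y, hW, hW', hWB, -⟩ := exists_diagonalization hB
  have hx : ∑ i, x i = 1 := by
    have h := hA1
    rw [hVA, trace_mul_cycle, hV', Matrix.one_mul, trace_diagonal] at h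
    exact_mod_cast h
  have hy : ∑ j, y j = 1 := by
    have h := hB1
    rw [hWB, trace_mul_cycle, hW', Matrix.one_mul, trace_diagonal] at h
    exact_mod_cast h
  have hAB : A ⊗ₖ B = (V ⊗ₖ W) * diagonal (fun p : a × b => ((x p.1 * y p.2 : ℝ) : ℂ)) *
      (V ⊗ₖ W)ᴴ := by
    rw [hVA, hWB, conjTranspose_kronecker, mul_kronecker_mul, mul_kronecker_mul,
      diagonal_kronecker_diagonal]
    simp only [Complex.ofReal_mul]
  have hVW : (V ⊗ₖ W)ᴴ * (V ⊗ₖ W) = 1 := by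
    rw [conjTranspose_kronecker, ← mul_kronecker_mul, hV', hW', one_kronecker_one]
  rw [hAB, entropy_conj_diagonal hVW, hVA, hWB, entropy_conj_diagonal hV',
    entropy_conj_diagonal hW', Fintype.sum_prod_type]
  simp only [Real.negMulLog_mul, Finset.sum_add_distrib, ← Finset.sum_mul, ← Finset.mul_sum, hx, hy,
    one_mul]

end PartialTrace

/-! ### Sums of unnormalized states -/

section KrausEntropy

variable {n ι : Type*} [Fintype n] [DecidableEq n] [Fintype ι]

/-- Let `W` be the block row of the `Z i`. Then `W * Wᴴ` is the sum on the left, while `Wᴴ * W`,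
which has the same entropy, is a state on `n × ι` whose marginal on `n` is the sum on the right and
whose marginal on `ι` has entropy at most the logarithm of the number of operators. With
`Z i = M i * B` and `ρ = B * Bᴴ` the left-hand side is the entropy of the output of the map with Kraus
operators `M i`. -/
lemma entropy_sum_mul_conjTranspose_le (Z : ι → Matrix n n ℂ) :
    entropy (∑ i, Z i * (Z i)ᴴ) ≤ entropy (∑ i, (Z i)ᴴ * Z i) +
      (∑ i, Z i * (Z i)ᴴ).trace.re * Real.log (Fintype.card ι) := by
  classical
  set G := (blockRow Z)ᴴ * blockRow Z with hG
  have hGpos : G.PosSemidef := posSemidef_conjTranspose_mul_self _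
  have h1 : entropy (∑ i, Z i * (Z i)ᴴ) = entropy G := by
    rw [← blockRow_mul_conjTranspose, entropy_mul_conjTranspose_comm]
  have h2 : traceSnd G = ∑ i, (Z i)ᴴ * Z i := by
    ext a b
    simp only [traceSnd, of_apply, hG, conjTranspose_blockRow_mul_apply, Matrix.sum_apply]
  have h3 : (∑ i, Z i * (Z i)ᴴ).trace = G.trace := by
    rw [← blockRow_mul_conjTranspose, trace_mul_comm]
  have h4 := entropy_add_negMulLog_trace_le hGpos
  have h5 := entropy_le_negMulLog_trace_add (posSemidef_traceFst hGpos)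
  rw [trace_traceFst] at h5
  rw [h1, h3, ← h2]
  linarith

/-- Concavity of the entropy, for unnormalized states: subadditivity applied to the block diagonal
state. -/
lemma sum_entropy_add_negMulLog_trace_le (R : ι → Matrix n n ℂ) (hR : ∀ k, (R k).PosSemidef) :
    ∑ k, entropy (R k) + Real.negMulLog (∑ k, R k).trace.re ≤
      entropy (∑ k, R k) + ∑ k, Real.negMulLog (R k).trace.re := by
  classical
  have hpos : (blockDiagonal R).PosSemidef := by
    choose B hB using fun k => exists_eq_mul_conjTranspose (hR k)
    have : blockDiagonal R = blockDiagonal B * (blockDiagonal B)ᴴ := by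
      rw [blockDiagonal_conjTranspose, ← blockDiagonal_mul, ← funext hB]
    rw [this]
    exact posSemidef_self_mul_conjTranspose _
  have hs : traceSnd (blockDiagonal R) = ∑ k, R k := by
    ext i j
    simp [traceSnd, Matrix.sum_apply]
  have hf : traceFst (blockDiagonal R) = diagonal fun k => (((R k).trace.re : ℝ) : ℂ) := by
    ext k l
    by_cases hkl : k = l
    · subst hkl
      have h := (Complex.nonneg_iff.1 (hR k).trace_nonneg).2
      have h2 : (((R k).trace.re : ℝ) : ℂ) = (R k).trace := Complex.ext (by simp) (by simpa using h)
      rw [diagonal_apply_eq, h2]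
      simp [traceFst, Matrix.trace]
    · simp [traceFst, blockDiagonal_apply, hkl]
  have h := entropy_add_negMulLog_trace_le hpos
  rw [← trace_traceSnd, hs, hf, entropy_diagonal,
    entropy_blockDiagonal _ fun k => (hR k).1] at h
  exact h

end KrausEntropy

/-! ### Kraus decompositions -/

section Kraus

variable {s : Type*} [Fintype s]

/-- A completely positive map has a Kraus decomposition: factorize its Choi matrix. -/
lemma IsCompletelyPositive.exists_isKrausFamily {T : Matrix s s ℂ →ₗ[ℂ] Matrix s s ℂ}
    (hT : IsCompletelyPositive T) : ∃ (N : ℕ) (M : Fin N → Matrix s s ℂ), IsKrausFamily T M := by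
  classical
  let e := Fintype.equivFin s
  let v : s × Fin (Fintype.card s) → ℂ := fun p => if p.1 = e.symm p.2 then 1 else 0
  obtain ⟨B, hB⟩ := exists_eq_mul_conjTranspose
    (hT (Fintype.card s) (vecMulVec v (star v)) (posSemidef_vecMulVec_self_star v))
  let M : s × Fin (Fintype.card s) → Matrix s s ℂ := fun r => Matrix.of fun i a => B (i, e a) r
  have hM : ∀ X, T X = ∑ r, M r * X * (M r)ᴴ := by
    let T' : Matrix s s ℂ →ₗ[ℂ] Matrix s s ℂ :=
      ∑ r, (LinearMap.mulRight ℂ (M r)ᴴ).comp (LinearMap.mulLeft ℂ (M r))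
    have hT' : ∀ X, T' X = ∑ r, M r * X * (M r)ᴴ := fun X => by
      simp [T', LinearMap.sum_apply]
    have : T = T' := by
      refine Matrix.ext_linearMap _ fun a b => LinearMap.ext_ring ?_
      ext i j
      have h := congrFun (congrFun hB (i, e a)) (j, e b)
      have hX : (Matrix.of fun i j => vecMulVec v (star v) (i, e a) (j, e b)) = single a b 1 := by
        ext i j
        simp only [v, of_apply, vecMulVec_apply, Equiv.symm_apply_apply, Pi.star_apply, single_apply]
        rw [eq_comm (a := a), eq_comm (a := b)]
        by_cases hi : i = a <;> by_cases hj : j = b <;> simp [hi, hj]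
      rw [of_apply, hX] at h
      simp only [LinearMap.comp_apply, singleLinearMap_apply, hT']
      rw [h, mul_apply, Matrix.sum_apply]
      refine Finset.sum_congr rfl fun r _ => ?_
      rw [mul_apply, Finset.sum_eq_single b]
      · simp [M]
      · intro c _ hc
        simp [hc]
      · simp
    intro X
    rw [this, hT']
  let f := Fintype.equivFin (s × Fin (Fintype.card s))
  exact ⟨_, M ∘ f.symm, fun X => by
    rw [hM, ← Equiv.sum_comp f.symm]
    rfl⟩

lemma IsCompletelyPositive.exists_isKrausFamily_krausRank {T : Matrix s s ℂ →ₗ[ℂ] Matrix s s ℂ}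
    (hT : IsCompletelyPositive T) : ∃ M : Fin (krausRank T) → Matrix s s ℂ, IsKrausFamily T M :=
  Nat.sInf_mem hT.exists_isKrausFamily

/-- The average entropy of the post-measurement states exceeds the entropy of the initial state by
at most the logarithm of the inefficiency; the sum of `Real.negMulLog` of the probabilities accounts
for the normalization of the outcome states. For efficient instruments this is the
Groenewold–Lindblad inequality. -/
lemma Instrument.sum_entropy_le {K : Type*} [Fintype K] [DecidableEq s] (𝒯 : Instrument K s)
    {ρ : Matrix s s ℂ} (hρ : IsState ρ) :
    ∑ k, entropy (𝒯.T k ρ) ≤ entropy ρ + ∑ k, Real.negMulLog (𝒯.T k ρ).trace.re +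
      Real.log 𝒯.inefficiency := by
  obtain ⟨B, hB⟩ := exists_eq_mul_conjTranspose hρ.posSemidef
  choose M hM using fun k => (𝒯.completelyPositive k).exists_isKrausFamily_krausRank
  have hT : ∀ k, 𝒯.T k ρ = ∑ i, (M k i * B) * (M k i * B)ᴴ := fun k => by
    rw [hM k, hB]
    simp only [conjTranspose_mul, Matrix.mul_assoc]
  set R : K → Matrix s s ℂ := fun k => ∑ i, (M k i * B)ᴴ * (M k i * B) with hR
  have hRpos : ∀ k, (R k).PosSemidef := fun k =>
    posSemidef_sum _ fun i _ => posSemidef_conjTranspose_mul_self _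
  have hTpos : ∀ k, (𝒯.T k ρ).PosSemidef := fun k => by
    rw [hT]
    exact posSemidef_sum _ fun i _ => posSemidef_self_mul_conjTranspose _
  have hRT : ∀ k, (R k).trace = (𝒯.T k ρ).trace := fun k => by
    rw [hT, hR, trace_sum, trace_sum]
    exact Finset.sum_congr rfl fun i _ => trace_mul_comm _ _
  have hE : ∑ k, ∑ i, (M k i)ᴴ * M k i = 1 := by
    refine ext_iff_trace_mul_right.2 fun X => ?_
    rw [Matrix.one_mul, ← 𝒯.trace_preserving X, Finset.sum_mul, trace_sum, trace_sum]
    refine Finset.sum_congr rfl fun k _ => ?_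
    rw [hM k, Finset.sum_mul, trace_sum, trace_sum]
    refine Finset.sum_congr rfl fun i _ => ?_
    rw [trace_mul_comm (M k i * X), Matrix.mul_assoc]
  have hRsum : ∑ k, R k = Bᴴ * B := by
    have : Bᴴ * (∑ k, ∑ i, (M k i)ᴴ * M k i) * B = ∑ k, R k := by
      simp only [hR, Finset.mul_sum, Finset.sum_mul, conjTranspose_mul, Matrix.mul_assoc]
    rw [← this, hE, Matrix.mul_one]
  have hBρ : entropy (Bᴴ * B) = entropy ρ := by rw [hB, entropy_mul_conjTranspose_comm]
  have htr : (Bᴴ * B).trace = 1 := by rw [trace_mul_comm, ← hB, hρ.trace_eq_one]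
  have h1 := sum_entropy_add_negMulLog_trace_le R hRpos
  rw [hRsum, hBρ, htr, Complex.one_re, Real.negMulLog_one, add_zero] at h1
  simp only [hRT] at h1
  have hp0 : ∀ k, 0 ≤ (𝒯.T k ρ).trace.re := fun k =>
    (Complex.nonneg_iff.1 (hTpos k).trace_nonneg).1
  have hp1 : ∑ k, (𝒯.T k ρ).trace.re = 1 := by
    rw [← Complex.re_sum, ← trace_sum, 𝒯.trace_preserving, hρ.trace_eq_one, Complex.one_re]
  have h2 : ∀ k, entropy (𝒯.T k ρ) ≤
      entropy (R k) + (𝒯.T k ρ).trace.re * Real.log 𝒯.inefficiency := fun k => by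
    have h3 := entropy_sum_mul_conjTranspose_le fun i => M k i * B
    rw [← hT, Fintype.card_fin] at h3
    have h4 : Real.log (krausRank (𝒯.T k)) ≤ Real.log 𝒯.inefficiency := by
      -- a map of Kraus rank zero contributes the junk value `log 0 = 0`
      rcases Nat.eq_zero_or_pos (krausRank (𝒯.T k)) with h0 | h0
      · rw [h0, Nat.cast_zero, Real.log_zero]
        exact Real.log_natCast_nonneg _
      · exact Real.log_le_log (by exact_mod_cast h0) (by
          exact_mod_cast Finset.le_sup (f := fun k => krausRank (𝒯.T k)) (Finset.mem_univ k))
    exact h3.trans (add_le_add_right (mul_le_mul_of_nonneg_left h4 (hp0 k)) _)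
  have h5 := Finset.sum_le_sum fun k (_ : k ∈ Finset.univ) => h2 k
  rw [Finset.sum_add_distrib, ← Finset.sum_mul, hp1, one_mul] at h5
  linarith

lemma Instrument.IsEfficient.inefficiency_le_one {K : Type*} [Fintype K] {𝒯 : Instrument K s}
    (h : 𝒯.IsEfficient) : 𝒯.inefficiency ≤ 1 := by
  refine Finset.sup_le fun k _ => Nat.sInf_le ?_
  obtain ⟨M, hM⟩ := h k
  exact ⟨fun _ => M, fun X => by simpa using hM X⟩

end Kraus

/-! ### Thermal states -/

section Thermal

variable {b : Type*} [Fintype b] [DecidableEq b]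

lemma exists_thermalState_eq (β : ℝ) {H : Matrix b b ℂ} (hH : H.IsHermitian) :
    ∃ (V : Matrix b b ℂ) (e : b → ℝ), V * Vᴴ = 1 ∧ Vᴴ * V = 1 ∧
      H = V * diagonal (fun i => (e i : ℂ)) * Vᴴ ∧
      thermalState β H = V * diagonal (fun i =>
        ((Real.exp (-β * e i) / ∑ j, Real.exp (-β * e j) : ℝ) : ℂ)) * Vᴴ := by
  obtain ⟨V, e, hV, hV', hVH, -⟩ := exists_diagonalization hH
  refine ⟨V, e, hV, hV', hVH, ?_⟩
  have hinv : V⁻¹ = Vᴴ := inv_eq_right_inv hV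
  have hexp : NormedSpace.exp (-(β : ℂ) • H) =
      V * diagonal (fun i => ((Real.exp (-β * e i) : ℝ) : ℂ)) * Vᴴ := by
    have h1 : -(β : ℂ) • H = V * diagonal (fun i => (((-β * e i : ℝ)) : ℂ)) * V⁻¹ := by
      have h2 : diagonal (fun i => (((-β * e i : ℝ)) : ℂ)) =
          -(β : ℂ) • diagonal (fun i => (e i : ℂ)) := by
        ext i j
        by_cases h : i = j <;> simp [h]
      rw [hinv, h2, hVH, Matrix.mul_smul, Matrix.smul_mul]
    rw [h1, exp_conj _ _ (isUnit_iff_exists.2 ⟨Vᴴ, hV, hV'⟩), exp_diagonal, hinv]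
    congr 3
    ext i
    rw [Pi.coe_exp, ← Complex.exp_eq_exp_ℂ, Complex.ofReal_exp]
  rw [thermalState, hexp, trace_mul_cycle, hV', Matrix.one_mul, trace_diagonal, ← Matrix.smul_mul,
    ← Matrix.mul_smul, ← diagonal_smul]
  congr 3
  ext i
  simp [div_eq_inv_mul]

lemma isState_thermalState [Nonempty b] (β : ℝ) {H : Matrix b b ℂ} (hH : H.IsHermitian) :
    IsState (thermalState β H) := by
  obtain ⟨V, e, -, hV', -, hτ⟩ := exists_thermalState_eq β hH
  have hZ : 0 < ∑ j, Real.exp (-β * e j) :=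
    Finset.sum_pos (fun j _ => Real.exp_pos _) Finset.univ_nonempty
  refine ⟨?_, ?_⟩
  · rw [hτ]
    refine PosSemidef.mul_mul_conjTranspose_same (PosSemidef.diagonal fun i => ?_) V
    have : 0 ≤ Real.exp (-β * e i) / ∑ j, Real.exp (-β * e j) := by positivity
    exact Complex.zero_le_real.2 this
  · rw [hτ, trace_mul_cycle, hV', Matrix.one_mul, trace_diagonal, ← Complex.ofReal_sum,
      ← Finset.sum_div, div_self hZ.ne', Complex.ofReal_one]

/-- The Gibbs variational principle: the thermal state minimizes the free energy. -/
lemma entropy_sub_entropy_thermalState_le [Nonempty b] (β : ℝ) {H σ : Matrix b b ℂ}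
    (hH : H.IsHermitian) (hσ : IsState σ) :
    entropy σ - entropy (thermalState β H) ≤ β * (H * (σ - thermalState β H)).trace.re := by
  obtain ⟨V, e, hV, hV', hVH, hτ⟩ := exists_thermalState_eq β hH
  set Z := ∑ j, Real.exp (-β * e j) with hZd
  have hZ : 0 < Z := Finset.sum_pos (fun j _ => Real.exp_pos _) Finset.univ_nonempty
  set t : b → ℝ := fun i => Real.exp (-β * e i) / Z with ht
  have ht0 : ∀ i, 0 < t i := fun i => by positivity
  have ht1 : ∑ i, t i = 1 := by rw [ht, ← Finset.sum_div, div_self hZ.ne']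
  have hlog : ∀ i, Real.log (t i) = -β * e i - Real.log Z := fun i => by
    rw [ht, Real.log_div (Real.exp_pos _).ne' hZ.ne', Real.log_exp]
  have hmean : ∀ X : Matrix b b ℂ, (H * X).trace.re = ∑ i, e i * ((Vᴴ * X * V) i i).re := by
    intro X
    rw [hVH, Matrix.mul_assoc, Matrix.mul_assoc, trace_mul_comm, Matrix.mul_assoc,
      Matrix.trace, Complex.re_sum]
    refine Finset.sum_congr rfl fun i _ => ?_
    rw [diag_apply, diagonal_mul, Complex.re_ofReal_mul]
  have hτd : Vᴴ * thermalState β H * V = diagonal fun i => (t i : ℂ) := by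
    rw [hτ, ← Matrix.mul_assoc, ← Matrix.mul_assoc, hV', Matrix.one_mul, Matrix.mul_assoc, hV',
      Matrix.mul_one]
  have hmτ : (H * thermalState β H).trace.re = ∑ i, e i * t i := by
    rw [hmean, hτd]
    simp
  have hSτ : entropy (thermalState β H) = β * (∑ i, e i * t i) + Real.log Z := by
    rw [hτ, entropy_conj_diagonal hV']
    have : ∀ i, Real.negMulLog (t i) = β * (e i * t i) + t i * Real.log Z := fun i => by
      rw [Real.negMulLog, hlog]
      ring
    rw [Finset.sum_congr rfl fun i _ => this i, Finset.sum_add_distrib, ← Finset.sum_mul, ht1,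
      Finset.mul_sum, one_mul]
  set d : b → ℝ := fun i => ((Vᴴ * σ * V) i i).re with hd
  have hd1 : ∑ i, d i = 1 := by
    have h : (Vᴴ * σ * V).trace = 1 := by
      rw [trace_mul_cycle, hV, Matrix.one_mul, hσ.trace_eq_one]
    have h2 := congrArg Complex.re h
    rw [Matrix.trace, Complex.re_sum] at h2
    exact h2
  have hSσ : entropy σ ≤ β * (∑ i, e i * d i) + Real.log Z := by
    refine (entropy_le_sum_negMulLog_diag hσ.posSemidef hV).trans ?_
    have h : ∀ i, Real.negMulLog (d i) ≤ β * (e i * d i) + d i * Real.log Z + t i - d i := fun i => by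
      have := negMulLog_le_tangent (diag_conj_nonneg hσ.posSemidef V i) (ht0 i).le
        fun h => absurd h (ht0 i).ne'
      rw [hlog] at this
      change _ ≤ -d i * _ + t i - d i at this
      linarith
    refine (Finset.sum_le_sum fun i _ => h i).trans (le_of_eq ?_)
    rw [Finset.sum_sub_distrib, Finset.sum_add_distrib, Finset.sum_add_distrib, ← Finset.sum_mul,
      hd1, ht1, Finset.mul_sum]
    ring
  rw [Matrix.mul_sub, trace_sub, Complex.sub_re, hmτ, hmean, hSτ]
  change _ ≤ β * (∑ i, e i * d i - _)
  linarith

end Thermal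

/-! ### The measurement step and the resetting step -/

/-- Projections that sum to one are mutually orthogonal. -/
lemma mul_eq_zero_of_sum_projections {K m : Type*} [Fintype K] [Fintype m] [DecidableEq m]
    {Q : K → Matrix m m ℂ} (hQ : ∀ k, (Q k).IsHermitian) (hQQ : ∀ k, Q k * Q k = Q k)
    (hsum : ∑ k, Q k = 1) {k l : K} (hkl : k ≠ l) : Q k * Q l = 0 := by
  classical
  -- conjugating the sum with `Q l` leaves a vanishing sum of the squares `(Q j Q l)ᴴ (Q j Q l)`
  have hsq : ∀ j, Q l * Q j * Q l = (Q j * Q l)ᴴ * (Q j * Q l) := fun j => by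
    rw [conjTranspose_mul, (hQ j).eq, (hQ l).eq, Matrix.mul_assoc, Matrix.mul_assoc,
      ← Matrix.mul_assoc (Q j) (Q j), hQQ]
  have h1 : ∑ j, Q l * Q j * Q l = Q l := by
    rw [← Finset.sum_mul, ← Finset.mul_sum, hsum, Matrix.mul_one, hQQ]
  rw [← Finset.add_sum_erase _ _ (Finset.mem_univ l), hQQ, hQQ, add_eq_left] at h1
  have hpos : ∀ j, (Q l * Q j * Q l).PosSemidef := fun j => by
    rw [hsq]
    exact posSemidef_conjTranspose_mul_self _
  have h2 := congrArg Matrix.trace h1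
  rw [trace_sum, trace_zero, Finset.sum_eq_zero_iff_of_nonneg fun j _ => (hpos j).trace_nonneg] at h2
  have h3 := (hpos k).trace_eq_zero_iff.1 (h2 k (Finset.mem_erase.2 ⟨hkl, Finset.mem_univ k⟩))
  rwa [hsq, conjTranspose_mul_self_eq_zero] at h3

namespace Device

variable {K s m : Type*} [Fintype K] [Fintype s] [DecidableEq s] [Fintype m] [DecidableEq m]

/-- The measurement step lowers the entropy of the memory by at most the logarithm of the
inefficiency of the implemented instrument. -/
lemma entropy_memory_le (D : Device K s m) {𝒯 : Instrument K s} (hD : D.Implements 𝒯)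
    {ρS : Matrix s s ℂ} (hρS : IsState ρS) :
    entropy D.ρM ≤ entropy (D.postMemory ρS) + Real.log 𝒯.inefficiency := by
  set X := D.U * (ρS ⊗ₖ D.ρM) * D.Uᴴ with hX
  have hU : D.Uᴴ * D.U = 1 := mem_unitaryGroup_iff'.1 D.unitary
  have hXpos : X.PosSemidef :=
    (hρS.posSemidef.kronecker D.isState.posSemidef).mul_mul_conjTranspose_same D.U
  have hXS : entropy X = entropy ρS + entropy D.ρM := by
    rw [hX, entropy_conj (hρS.posSemidef.kronecker D.isState.posSemidef).1 hU,
      entropy_kronecker hρS.posSemidef.1 D.isState.posSemidef.1 hρS.trace_eq_one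
        D.isState.trace_eq_one]
  set P : K → Matrix (s × m) (s × m) ℂ := fun k => (1 : Matrix s s ℂ) ⊗ₖ D.Q k with hP
  have hPh : ∀ k, (P k)ᴴ = P k := fun k => by
    rw [hP, conjTranspose_kronecker, conjTranspose_one, (D.Q_isHermitian k).eq]
  have hPsum : ∑ k, P k * (P k)ᴴ = 1 := by
    have : ∀ k, P k * (P k)ᴴ = P k := fun k => by
      rw [hPh, hP, ← mul_kronecker_mul, Matrix.mul_one, D.Q_idempotent]
    simp only [this]
    ext p q
    have hQ := congrFun (congrFun D.Q_sum p.2) q.2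
    rw [Matrix.sum_apply] at hQ
    rw [← one_kronecker_one, Matrix.sum_apply, kroneckerMap_apply, ← hQ, Finset.mul_sum]
    rfl
  have hbr : ∀ k, D.branch ρS k = (P k)ᴴ * X * P k := fun k => by
    rw [hPh]
    rfl
  have hbpos : ∀ k, (D.branch ρS k).PosSemidef := fun k => by
    rw [hbr]
    exact hXpos.conjTranspose_mul_mul_same _
  have h1 : entropy X ≤ ∑ k, entropy (D.branch ρS k) := by
    simp only [hbr]
    exact entropy_le_sum_entropy_conj hXpos hPsum
  have h2 : ∀ k, entropy (D.branch ρS k) + Real.negMulLog (𝒯.T k ρS).trace.re ≤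
      entropy (𝒯.T k ρS) + entropy (traceFst (D.branch ρS k)) := fun k => by
    have h := entropy_add_negMulLog_trace_le (hbpos k)
    rwa [← trace_traceSnd, hD ρS hρS k] at h
  have hfst : ∀ k, traceFst (D.branch ρS k) = D.Q k * traceFst X * (D.Q k)ᴴ := fun k => by
    rw [(D.Q_isHermitian k).eq]
    exact traceFst_conj_kronecker X _ _ (Matrix.one_mul 1)
  have hpost : D.postMemory ρS = ∑ k, traceFst (D.branch ρS k) := by
    ext i j
    simp only [postMemory, postState, traceFst, of_apply, Matrix.sum_apply]
    exact Finset.sum_comm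
  have h3 : entropy (D.postMemory ρS) = ∑ k, entropy (traceFst (D.branch ρS k)) := by
    rw [hpost]
    simp only [hfst]
    refine entropy_sum_orthogonal (posSemidef_traceFst hXpos) fun k l hkl => ?_
    rw [(D.Q_isHermitian k).eq]
    exact mul_eq_zero_of_sum_projections D.Q_isHermitian D.Q_idempotent D.Q_sum hkl
  have h4 := Finset.sum_le_sum fun k (_ : k ∈ Finset.univ) => h2 k
  rw [Finset.sum_add_distrib, Finset.sum_add_distrib, ← h3] at h4
  have h5 := 𝒯.sum_entropy_le hρS
  linarith

lemma isState_postMemory (D : Device K s m) {𝒯 : Instrument K s} (hD : D.Implements 𝒯)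
    {ρS : Matrix s s ℂ} (hρS : IsState ρS) : IsState (D.postMemory ρS) := by
  refine ⟨posSemidef_traceFst (posSemidef_sum _ fun k _ => ?_), ?_⟩
  · have h : ((1 : Matrix s s ℂ) ⊗ₖ D.Q k)ᴴ = 1 ⊗ₖ D.Q k := by
      rw [conjTranspose_kronecker, conjTranspose_one, (D.Q_isHermitian k).eq]
    have h2 := ((hρS.posSemidef.kronecker D.isState.posSemidef).mul_mul_conjTranspose_same
      D.U).mul_mul_conjTranspose_same ((1 : Matrix s s ℂ) ⊗ₖ D.Q k)
    rwa [h] at h2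
  · rw [postMemory, trace_traceFst, postState, trace_sum, ← hρS.trace_eq_one,
      ← 𝒯.trace_preserving ρS, trace_sum]
    exact Finset.sum_congr rfl fun k _ => by rw [← hD ρS hρS k, trace_traceSnd]

/-- Landauer's principle: up to the change of the mean energy of the memory, which cancels against
that of the measurement step, resetting costs at least `(S(ρ'_M) - S(ρ_M)) / β`. -/
lemma Reset.entropy_sub_le_cost {D : Device K s m} {β : ℝ} {ρS : Matrix s s ℂ} {b : Type*}
    [Fintype b] [DecidableEq b] (R : D.Reset β ρS b) (HM : Matrix m m ℂ)
    (hρ : IsState (D.postMemory ρS)) :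
    entropy (D.postMemory ρS) - entropy D.ρM ≤
      β * (R.cost HM + energyChange HM D.ρM (D.postMemory ρS)) := by
  -- a bath of dimension zero cannot restore a memory state of trace one
  have : Nonempty b := by
    by_contra h
    rw [not_nonempty_iff] at h
    have h0 : D.ρM = 0 := by
      rw [← R.resets]
      ext i j
      simp [traceSnd]
    simpa [h0] using D.isState.trace_eq_one
  have hτ := isState_thermalState β R.HB_isHermitian
  set τ := thermalState β R.HB with hτd
  set ω := D.postMemory ρS ⊗ₖ τ with hω
  have hωpos : ω.PosSemidef := hρ.posSemidef.kronecker hτ.posSemidef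
  set Y := R.U * ω * R.Uᴴ with hY
  have hU : R.Uᴴ * R.U = 1 := mem_unitaryGroup_iff'.1 R.unitary
  have hYpos : Y.PosSemidef := hωpos.mul_mul_conjTranspose_same R.U
  have hωtr : ω.trace = 1 := by
    rw [← trace_traceSnd, hω, traceSnd_kronecker, hτ.trace_eq_one, one_smul, hρ.trace_eq_one]
  have hYtr : Y.trace = 1 := by rw [hY, trace_mul_cycle, hU, Matrix.one_mul, hωtr]
  have hYS : entropy Y = entropy (D.postMemory ρS) + entropy τ := by
    rw [hY, entropy_conj hωpos.1 hU,
      entropy_kronecker hρ.posSemidef.1 hτ.posSemidef.1 hρ.trace_eq_one hτ.trace_eq_one]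
  have h1 := entropy_add_negMulLog_trace_le hYpos
  rw [hYtr, Complex.one_re, Real.negMulLog_one, add_zero, hYS, R.resets] at h1
  have hB : IsState (traceFst Y) := ⟨posSemidef_traceFst hYpos, by rw [trace_traceFst, hYtr]⟩
  have h2 := entropy_sub_entropy_thermalState_le β R.HB_isHermitian hB
  have hcost : R.cost HM = (HM * (D.ρM - D.postMemory ρS)).trace.re +
      (R.HB * (traceFst Y - τ)).trace.re := by
    have hs : traceSnd (Y - ω) = D.ρM - D.postMemory ρS := by
      have : traceSnd (Y - ω) = traceSnd Y - traceSnd ω := by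
        ext i j
        simp [traceSnd]
      rw [this, hω, traceSnd_kronecker, hτ.trace_eq_one, one_smul, R.resets]
    have hf : traceFst (Y - ω) = traceFst Y - τ := by
      have : traceFst (Y - ω) = traceFst Y - traceFst ω := by
        ext i j
        simp [traceFst]
      rw [this, hω, traceFst_kronecker, hρ.trace_eq_one, one_smul]
    change ((HM ⊗ₖ (1 : Matrix b b ℂ) + (1 : Matrix m m ℂ) ⊗ₖ R.HB) * (Y - ω)).trace.re = _
    rw [Matrix.add_mul, trace_add, trace_kronecker_one_mul, trace_one_kronecker_mul, hs, hf,
      Complex.add_re]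
  have hneg : (HM * (D.ρM - D.postMemory ρS)).trace.re =
      -energyChange HM D.ρM (D.postMemory ρS) := by
    rw [energyChange, ← neg_sub (D.postMemory ρS), Matrix.mul_neg, trace_neg, Complex.neg_re]
  rw [hcost, hneg]
  linarith

lemma entropy_sub_eq_idealResetCost (D : Device K s m) {β : ℝ} (hβ : β ≠ 0) (HM : Matrix m m ℂ)
    (ρS : Matrix s s ℂ) :
    entropy (D.postMemory ρS) - entropy D.ρM =
      β * (D.idealResetCost β HM ρS + energyChange HM D.ρM (D.postMemory ρS)) := by
  rw [idealResetCost, freeEnergy, freeEnergy, energyChange, Matrix.mul_sub, trace_sub,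
    Complex.sub_re, trace_mul_comm _ HM, trace_mul_comm _ HM]
  field_simp
  ring

lemma traceSnd_postState (D : Device K s m) {𝒯 : Instrument K s} (hD : D.Implements 𝒯)
    {ρS : Matrix s s ℂ} (hρS : IsState ρS) :
    traceSnd (D.postState ρS) = 𝒯.averageState ρS := by
  rw [Instrument.averageState, ← Finset.sum_congr rfl fun k _ => hD ρS hρS k]
  ext i j
  simp only [postState, traceSnd, of_apply, Matrix.sum_apply]
  exact Finset.sum_comm

end Device

end QMeasurement

end

theorem mainTheorem6 {K s m : Type*} [Fintype K] [Fintype s] [DecidableEq s] [Fintype m]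
    [DecidableEq m] (β : ℝ) (hβ : 0 < β)
    (HS : Matrix s s ℂ) (hHS : HS.IsHermitian) (HM : Matrix m m ℂ) (hHM : HM.IsHermitian)
    (𝒯 : QMeasurement.Instrument K s) (D : QMeasurement.Device K s m) (hD : D.Implements 𝒯)
    (ρS : Matrix s s ℂ) (hρS : QMeasurement.IsState ρS)
    (Ecost : ℝ) (hE : D.IsEnergyCost β HS HM ρS Ecost) :
    β * Ecost ≥ β * QMeasurement.energyChange HS ρS (𝒯.averageState ρS)
        - Real.log (𝒯.inefficiency : ℝ) ∧
      (𝒯.IsEfficient →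
        QMeasurement.energyChange HS ρS (𝒯.averageState ρS) - Ecost ≤ 0) := by
  have hM := D.entropy_memory_le hD hρS
  have hmain : β * Ecost ≥ β * QMeasurement.energyChange HS ρS (𝒯.averageState ρS)
      - Real.log (𝒯.inefficiency : ℝ) := by
    cases hE with
    | ideal =>
      have h := D.entropy_sub_eq_idealResetCost hβ.ne' HM ρS
      rw [QMeasurement.Device.measurementCost, D.traceSnd_postState hD hρS]
      linarith
    | bath d R =>
      have h := R.entropy_sub_le_cost HM (D.isState_postMemory hD hρS)
      rw [QMeasurement.Device.measurementCost, D.traceSnd_postState hD hρS]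
      linarith
  refine ⟨hmain, fun heff => ?_⟩
  have hlog : Real.log (𝒯.inefficiency : ℝ) ≤ 0 :=
    Real.log_nonpos (Nat.cast_nonneg _) (by exact_mod_cast heff.inefficiency_le_one)
  by_contra! hpos
  have := mul_pos hβ hpos
  linarith
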